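/- Let $\Gamma$ and $\Sigma$ be finite simple graphs with vertex sets $X$ and $Y$. Assume that $\Gamma$ is connected, that $\Sigma$ is regular with $|Y|\ge 2$, and that $\Gamma$ is pseudo-distance-regular around a vertex $x\in X$. The last condition means: there is an eigenvector $\alpha$ of the adjacency matrix of $\Gamma$ with all entries positive such that, for every $i\ge 0$ and every vertex $z$ at distance $i$ from $x$, each of the three sums $\sum_u \alpha_u/\alpha_z$, taken over the neighbours $u$ of $z$ at distance $i-1$, $i$, $i+1$ from $x$ respectively, depends only on $i$ and not on $z$. Let $H=H(\Gamma,\Sigma)$ be the graph obtained from the Cartesian product $\Gamma\,\square\,\Sigma$ by adding a new vertex $w$ that is adjacent exactly to the vertices $(x,y)$ with $y\in Y$. Let $V$ be the space of complex column vectors indexed by the vertices of $H$, let $E_i^*$ $(i\ge 0)$ be the diagonal matrix whose $(v,v)$-entry is $1$ if $v$ is at distance $i$ from $w$ in $H$ and $0$ otherwise, and let $T=T(w)$ be the algebra of complex matrices generated by the adjacency matrix of $H$ and all the $E_i^*$. A $T$-module is a subspace $W\subseteq V$ with $TW\subseteq W$. It is irreducible if $W\neq 0$ and its only $T$-submodules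 are $0$ and $W$. Its endpoint is the least $i$ with $E_i^*W\ne 0$, and it is thin if $\dim E_i^*W\le 1$ for all $i$. Two $T$-modules are isomorphic if there is a linear isomorphism between them that commutes with the action of $T$. Then the following are equivalent: (i) up to isomorphism, there is exactly one irreducible $T$-module with endpoint $1$, and this module is thin; (ii) $\Sigma$ is isomorphic to the empty graph $S_n$ on $n$ vertices for some $n\ge 2$, or to the complete graph $K_n$ for some $n\ge 2$. -/

import Mathlib

namespace TerwilligerGraph

open Matrix

section PseudoDistanceRegular

variable {V : Type*} [Fintype V]

open Classical in
/-- For a positive weight `α` on the vertices: the sum of `α u / α z` over all neighbours `u` of `z`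
whose distance to the base vertex `x` is `j`. -/
noncomputable def weightedCount (G : SimpleGraph V) (x : V) (α : V → ℝ) (z : V) (j : ℕ) : ℝ :=
  ∑ u : V, if G.Adj z u ∧ G.dist x u = j then α u / α z else 0

open Classical in
/-- Pseudo-distance-regularity of a connected graph around `x` (Fiol and Garriga). The weight `α` is
a positive eigenvector of the adjacency matrix; for a connected graph it is unique up to a positive
scalar, which the ratios `α u / α z` do not see. For `z` at distance `i` from `x` the three weighted
intersection numbers `c i`, `a i`, `b i` of `z` (neighbours at distance `i - 1`, `i`, `i + 1`
from `x`) depend only on `i`. -/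
def IsPseudoDistanceRegularAround (G : SimpleGraph V) (x : V) : Prop :=
  ∃ (α : V → ℝ) (ev : ℝ), (∀ v, 0 < α v) ∧ G.adjMatrix ℝ *ᵥ α = ev • α ∧
    ∃ c a b : ℕ → ℝ,
      (∀ (i : ℕ) (z : V), G.dist x z = i + 1 → weightedCount G x α z i = c (i + 1)) ∧
      (∀ (i : ℕ) (z : V), G.dist x z = i → weightedCount G x α z i = a i) ∧
      (∀ (i : ℕ) (z : V), G.dist x z = i → weightedCount G x α z (i + 1) = b i)

end PseudoDistanceRegular

section Terwilliger

variable {V : Type*} [Fintype V] [DecidableEq V]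

/-- The `i`-th dual idempotent with respect to `x`. In a connected graph it is the zero matrix
when `i` exceeds the eccentricity of `x`. -/
noncomputable def dualIdempotent (G : SimpleGraph V) (x : V) (i : ℕ) : Matrix V V ℂ :=
  Matrix.diagonal fun y => if G.dist x y = i then 1 else 0

open Classical in
/-- The Terwilliger algebra `T(x)`: the subalgebra of the full complex matrix algebra generated by
the adjacency matrix and the dual idempotents with respect to `x`. -/
noncomputable def terwilligerAlgebra (G : SimpleGraph V) (x : V) :
    Subalgebra ℂ (Matrix V V ℂ) :=
  Algebra.adjoin ℂ (insert (G.adjMatrix ℂ) (Set.range (dualIdempotent G x)))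

/-- `W` is a `T(x)`-module: a subspace of the standard module closed under the action of `T(x)`. -/
def IsTModule (G : SimpleGraph V) (x : V) (W : Submodule ℂ (V → ℂ)) : Prop :=
  ∀ B ∈ terwilligerAlgebra G x, ∀ v ∈ W, B *ᵥ v ∈ W

/-- `W` is an irreducible `T(x)`-module. -/
def IsIrreducibleTModule (G : SimpleGraph V) (x : V) (W : Submodule ℂ (V → ℂ)) : Prop :=
  IsTModule G x W ∧ W ≠ ⊥ ∧ ∀ U ≤ W, IsTModule G x U → U = ⊥ ∨ U = W

/-- The subspace `E_i^* W`. -/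
noncomputable def component (G : SimpleGraph V) (x : V) (i : ℕ) (W : Submodule ℂ (V → ℂ)) :
    Submodule ℂ (V → ℂ) :=
  W.map (dualIdempotent G x i).mulVecLin

/-- `W` has endpoint `r`: the least `i` with `E_i^* W ≠ 0` is `r`. -/
def HasEndpoint (G : SimpleGraph V) (x : V) (W : Submodule ℂ (V → ℂ)) (r : ℕ) : Prop :=
  IsLeast {i | component G x i W ≠ ⊥} r

/-- `W` is thin: every `E_i^* W` has dimension at most `1`. -/
def IsThin (G : SimpleGraph V) (x : V) (W : Submodule ℂ (V → ℂ)) : Prop :=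
  ∀ i : ℕ, Module.finrank ℂ (component G x i W) ≤ 1

/-- `W` and `W'` are `T(x)`-isomorphic: some linear isomorphism `σ : W → W'` satisfies
`σ (B u) = B (σ u)` for all `B ∈ T(x)` and `u ∈ W` (the variable `v` is the vector `B u` of `W`). -/
def TIsomorphic (G : SimpleGraph V) (x : V) (W W' : Submodule ℂ (V → ℂ)) : Prop :=
  ∃ σ : W ≃ₗ[ℂ] W', ∀ B ∈ terwilligerAlgebra G x, ∀ u v : W,
    (v : V → ℂ) = B *ᵥ (u : V → ℂ) → (σ v : V → ℂ) = B *ᵥ (σ u : V → ℂ)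

/-- Up to isomorphism there is exactly one irreducible `T(x)`-module with endpoint `1`, and it is
thin. -/
def HasUniqueThinEndpointOne (G : SimpleGraph V) (x : V) : Prop :=
  ∃ W : Submodule ℂ (V → ℂ),
    (IsIrreducibleTModule G x W ∧ HasEndpoint G x W 1) ∧ IsThin G x W ∧
      ∀ W' : Submodule ℂ (V → ℂ),
        IsIrreducibleTModule G x W' → HasEndpoint G x W' 1 → TIsomorphic G x W W'

end Terwilliger

section Construction

variable {X Y : Type*}

/-- The adjacency relation of `H(G, S)`; the new vertex `w` is `none`. -/
def coneAdj (G : SimpleGraph X) (S : SimpleGraph Y) (x : X) :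
    Option (X × Y) → Option (X × Y) → Prop
  | none, none => False
  | none, some q => q.1 = x
  | some p, none => p.1 = x
  | some p, some q => (G.boxProd S).Adj p q

/-- The graph `H(G, S)`: the Cartesian product of `G` and `S` together with a new vertex `none`
adjacent to exactly the vertices `(x, y)`, `y` a vertex of `S`. -/
def coneGraph (G : SimpleGraph X) (S : SimpleGraph Y) (x : X) : SimpleGraph (Option (X × Y)) where
  Adj := coneAdj G S x
  symm := ⟨by
    rintro (_ | p) (_ | q) h
    · exact h
    · exact h
    · exact h
    · exact SimpleGraph.Adj.symm (G := G.boxProd S) h⟩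
  loopless := ⟨by
    rintro (_ | p) h
    · exact h
    · exact (G.boxProd S).loopless.irrefl p h⟩

end Construction

end TerwilligerGraph

/-!
Let `H` be the cone graph, `A` its adjacency matrix and `α` the weight that makes the distance
partition of `G` around `x` weight-regular. If `v` is an eigenvector of `S` with coordinate sum
zero, then the vectors `(f ∘ dist x) α ⊗ v` form a `T`-module: `A` acts on the sequence `f` through
the quotient matrix of the partition plus the eigenvalue of `v`, and the sum of `v` over the
neighbours of the new vertex vanishes. Each `E_i^*` picks out one term of `f`, so the module is
thin, and connectedness of `G` lets `A` and the `E_i^*` carry any nonzero term to every other one,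
so it is irreducible. Its endpoint is `1`, and `E_1^* A E_1^*` acts on its `E_1^*`-component as the
eigenvalue of `v`, which is therefore an isomorphism invariant.

Hence if all irreducible modules of endpoint `1` are isomorphic, then `S` has at most one eigenvalue
on the space of sum-zero vectors, which it preserves by regularity; its adjacency matrix is
symmetric, so it acts there as a scalar, and evaluating at differences of two coordinate vectors
leaves only the empty and the complete graph. Conversely, if `S` acts there as a scalar, then an
irreducible module of endpoint `1` vanishes at the new vertex, so its vectors have sum zero on the
first subconstituent. Such a restriction, if nonzero, is an eigenvector of `S`, and the module
attached to it is the whole module.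
-/

namespace TerwilligerGraph

open Matrix

section LinearAlgebra

theorem exists_linearEquiv_range_of_ker_eq {R M N P : Type*} [Ring R] [AddCommGroup M]
    [AddCommGroup N] [AddCommGroup P] [Module R M] [Module R N] [Module R P] {f : M →ₗ[R] N}
    {g : M →ₗ[R] P} (h : LinearMap.ker f = LinearMap.ker g) :
    ∃ σ : LinearMap.range f ≃ₗ[R] LinearMap.range g, ∀ m, σ (f.rangeRestrict m) = g m :=
  ⟨f.quotKerEquivRange.symm ≪≫ₗ Submodule.quotEquivOfEq _ _ h ≪≫ₗ g.quotKerEquivRange, fun m => by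
    have hm : f.quotKerEquivRange.symm (f.rangeRestrict m) = Submodule.Quotient.mk m :=
      f.quotKerEquivRange_symm_apply_image m _
    rw [LinearEquiv.trans_apply, LinearEquiv.trans_apply, hm, Submodule.quotEquivOfEq_mk,
      LinearMap.quotKerEquivRange_apply_mk]⟩

theorem exists_eq_smul_id_of_subsingleton_eigenvalues {𝕜 E : Type*} [RCLike 𝕜]
    [NormedAddCommGroup E] [InnerProductSpace 𝕜 E] [FiniteDimensional 𝕜 E] {T : E →ₗ[𝕜] E}
    (hT : T.IsSymmetric)
    (huniq : ∀ μ ν, Module.End.HasEigenvalue T μ → Module.End.HasEigenvalue T ν → μ = ν) :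
    ∃ θ : 𝕜, ∀ v, T v = θ • v := by
  obtain ⟨θ, hθ⟩ : ∃ θ, ∀ μ, Module.End.HasEigenvalue T μ → μ = θ := by
    by_cases h : ∃ θ, Module.End.HasEigenvalue T θ
    · exact h.imp fun θ hθ μ hμ => huniq μ θ hμ hθ
    · exact ⟨0, fun μ hμ => (h ⟨μ, hμ⟩).elim⟩
  have htop : ⨆ μ, Module.End.eigenspace T μ = ⊤ :=
    Submodule.orthogonal_eq_bot_iff.1 hT.orthogonalComplement_iSup_eigenspaces_eq_bot
  have hle : ⨆ μ, Module.End.eigenspace T μ ≤ Module.End.eigenspace T θ := by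
    refine iSup_le fun μ => ?_
    by_cases hμ : Module.End.eigenspace T μ = ⊥
    · exact hμ ▸ bot_le
    · rw [hθ μ hμ]
  exact ⟨θ, fun v => Module.End.mem_eigenspace_iff.1 (hle (htop ▸ Submodule.mem_top))⟩

end LinearAlgebra

section Distance

theorem dist_eq_of_lipschitz_of_descent {V : Type*} {H : SimpleGraph V} {w : V} {h : V → ℕ}
    (hw : h w = 0) (hadj : ∀ p q, H.Adj p q → h q ≤ h p + 1)
    (hdesc : ∀ p, p ≠ w → ∃ q, H.Adj p q ∧ h q + 1 = h p) (p : V) : H.dist w p = h p := by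
  have le_add_length : ∀ {p q : V} (P : H.Walk p q), h q ≤ h p + P.length := by
    intro p q P
    induction P with
    | nil => exact le_rfl
    | @cons p r _ hpr P ih =>
      have := hadj p r hpr
      rw [SimpleGraph.Walk.length_cons]
      omega
  obtain ⟨P, hP⟩ : ∃ P : H.Walk p w, P.length = h p := by
    induction hp : h p using Nat.strong_induction_on generalizing p with
    | _ n ih =>
      obtain rfl | hpw := eq_or_ne p w
      · exact ⟨.nil, hw.symm.trans hp⟩
      · obtain ⟨q, hpq, hq⟩ := hdesc p hpw
        obtain ⟨P, hP⟩ := ih (h q) (by omega) q rfl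
        exact ⟨.cons hpq P, by rw [SimpleGraph.Walk.length_cons, hP, hq, hp]⟩
  obtain ⟨Q, hQ⟩ := P.reverse.reachable.exists_walk_length_eq_dist
  refine le_antisymm ?_ ?_
  · rw [← hP, ← P.length_reverse]
    exact SimpleGraph.dist_le _
  · simpa [hw, hQ] using le_add_length Q

variable {X : Type*} {G : SimpleGraph X} {x : X}

theorem exists_adj_dist_add_one_eq (hG : G.Connected) {z : X} (hz : z ≠ x) :
    ∃ u, G.Adj z u ∧ G.dist x u + 1 = G.dist x z := by
  obtain ⟨P, hP⟩ := hG.exists_walk_length_eq_dist z x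
  cases P with
  | nil => exact absurd rfl hz
  | @cons _ u _ hzu P =>
    refine ⟨u, hzu, ?_⟩
    have hle := SimpleGraph.dist_le P
    have htri := hG.dist_triangle (u := z) (v := u) (w := x)
    rw [SimpleGraph.dist_eq_one_iff_adj.2 hzu] at htri
    rw [SimpleGraph.Walk.length_cons] at hP
    rw [SimpleGraph.dist_comm, G.dist_comm (u := x)]
    omega

variable {Y : Type*} {S : SimpleGraph Y}

theorem coneGraph_dist_some (hG : G.Connected) (z : X) (y : Y) :
    (coneGraph G S x).dist none (some (z, y)) = G.dist x z + 1 := by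
  refine dist_eq_of_lipschitz_of_descent
    (h := fun q : Option (X × Y) => q.elim 0 fun r => G.dist x r.1 + 1) rfl ?_ ?_ (some (z, y))
  · rintro (_ | ⟨z, y⟩) (_ | ⟨u, y'⟩) hadj
    · exact hadj.elim
    · obtain rfl : u = x := hadj
      simp
    · simp
    · obtain ⟨hzu, -⟩ | ⟨-, rfl : z = u⟩ := SimpleGraph.boxProd_adj.1 hadj
      · have hdist := SimpleGraph.Adj.diff_dist_adj (u := x) (show G.Adj z u from hzu)
        change G.dist x u + 1 ≤ G.dist x z + 1 + 1
        omega
      · exact Nat.le_succ _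
  · rintro (_ | ⟨z, y⟩) hp
    · exact absurd rfl hp
    obtain rfl | hz := eq_or_ne z x
    · exact ⟨none, rfl, by simp⟩
    · obtain ⟨u, hzu, hu⟩ := exists_adj_dist_add_one_eq hG hz
      exact ⟨some (u, y), SimpleGraph.boxProd_adj.2 (Or.inl ⟨hzu, rfl⟩), congrArg (· + 1) hu⟩

end Distance

section TModule

variable {V : Type*} [Fintype V] [DecidableEq V] {H : SimpleGraph V} {w : V}
  {W W' W'' : Submodule ℂ (V → ℂ)}

open Classical in
theorem adjMatrix_mem_terwilligerAlgebra (H : SimpleGraph V) (w : V) :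
    H.adjMatrix ℂ ∈ terwilligerAlgebra H w :=
  Algebra.subset_adjoin (Set.mem_insert _ _)

theorem dualIdempotent_mem_terwilligerAlgebra (H : SimpleGraph V) (w : V) (i : ℕ) :
    dualIdempotent H w i ∈ terwilligerAlgebra H w :=
  Algebra.subset_adjoin (Set.mem_insert_of_mem _ ⟨i, rfl⟩)

open Classical in
/-- The operator `E_1^* A E_1^*`, that is, the adjacency matrix of the graph induced on the
neighbours of `w`, extended by zero. It tells the modules of endpoint `1` apart. -/
noncomputable def localOperator (H : SimpleGraph V) (w : V) : Matrix V V ℂ :=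
  dualIdempotent H w 1 * H.adjMatrix ℂ * dualIdempotent H w 1

theorem localOperator_mem_terwilligerAlgebra (H : SimpleGraph V) (w : V) :
    localOperator H w ∈ terwilligerAlgebra H w :=
  mul_mem (mul_mem (dualIdempotent_mem_terwilligerAlgebra H w 1)
    (adjMatrix_mem_terwilligerAlgebra H w)) (dualIdempotent_mem_terwilligerAlgebra H w 1)

theorem dualIdempotent_mulVec_apply (H : SimpleGraph V) (w : V) (i : ℕ) (g : V → ℂ) (q : V) :
    (dualIdempotent H w i *ᵥ g) q = if H.dist w q = i then g q else 0 := by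
  simp [dualIdempotent, mulVec_diagonal]

open Classical in
theorem isTModule_iff : IsTModule H w W ↔ (∀ g ∈ W, H.adjMatrix ℂ *ᵥ g ∈ W) ∧
    ∀ i, ∀ g ∈ W, dualIdempotent H w i *ᵥ g ∈ W := by
  refine ⟨fun hW => ⟨hW _ (adjMatrix_mem_terwilligerAlgebra H w),
    fun i => hW _ (dualIdempotent_mem_terwilligerAlgebra H w i)⟩, fun ⟨hA, hE⟩ B hB => ?_⟩
  induction hB using Algebra.adjoin_induction with
  | mem B hB =>
    obtain rfl | ⟨i, rfl⟩ := hB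
    exacts [hA, hE i]
  | algebraMap r =>
    intro g hg
    rw [Algebra.algebraMap_eq_smul_one, smul_mulVec, one_mulVec]
    exact W.smul_mem r hg
  | add B C _ _ hB hC =>
    intro g hg
    rw [add_mulVec]
    exact W.add_mem (hB g hg) (hC g hg)
  | mul B C _ _ hB hC =>
    intro g hg
    rw [← mulVec_mulVec]
    exact hB _ (hC g hg)

open Classical in
theorem IsTModule.adjMatrix_mulVec_mem (hW : IsTModule H w W) {g : V → ℂ} (hg : g ∈ W) :
    H.adjMatrix ℂ *ᵥ g ∈ W :=
  (isTModule_iff.1 hW).1 g hg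

theorem IsTModule.dualIdempotent_mulVec_mem (hW : IsTModule H w W) (i : ℕ) {g : V → ℂ}
    (hg : g ∈ W) : dualIdempotent H w i *ᵥ g ∈ W :=
  (isTModule_iff.1 hW).2 i g hg

open Classical in
theorem tIsomorphic_of_commute_generators (hW : IsTModule H w W) (σ : W ≃ₗ[ℂ] W')
    (hA : ∀ u v : W, (v : V → ℂ) = H.adjMatrix ℂ *ᵥ u → (σ v : V → ℂ) = H.adjMatrix ℂ *ᵥ σ u)
    (hE : ∀ i, ∀ u v : W, (v : V → ℂ) = dualIdempotent H w i *ᵥ u →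
      (σ v : V → ℂ) = dualIdempotent H w i *ᵥ σ u) :
    TIsomorphic H w W W' := by
  refine ⟨σ, fun B hB => ?_⟩
  induction hB using Algebra.adjoin_induction with
  | mem B hB =>
    obtain rfl | ⟨i, rfl⟩ := hB
    exacts [hA, hE i]
  | algebraMap r =>
    intro u v hv
    rw [Algebra.algebraMap_eq_smul_one, smul_mulVec, one_mulVec] at hv ⊢
    rw [show v = r • u from Subtype.ext hv, map_smul, Submodule.coe_smul]
  | add B C hBT hCT hB hC =>
    intro u v hv
    have hsum : v = ⟨B *ᵥ u, hW B hBT u u.2⟩ + ⟨C *ᵥ u, hW C hCT u u.2⟩ :=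
      Subtype.ext (hv.trans (add_mulVec B C u))
    rw [hsum, map_add, Submodule.coe_add, hB u ⟨B *ᵥ u, hW B hBT u u.2⟩ rfl,
      hC u ⟨C *ᵥ u, hW C hCT u u.2⟩ rfl, add_mulVec]
  | mul B C _ hCT hB hC =>
    intro u v hv
    rw [← mulVec_mulVec] at hv ⊢
    rw [hB ⟨C *ᵥ u, hW C hCT u u.2⟩ v hv, hC u ⟨C *ᵥ u, hW C hCT u u.2⟩ rfl]

theorem TIsomorphic.symm (hW : IsTModule H w W) (h : TIsomorphic H w W W') :
    TIsomorphic H w W' W := by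
  obtain ⟨σ, hσ⟩ := h
  refine ⟨σ.symm, fun B hB u v hv => ?_⟩
  have himage : σ ⟨B *ᵥ σ.symm u, hW B hB _ (σ.symm u).2⟩ = v := by
    refine Subtype.ext ((hσ B hB (σ.symm u) _ rfl).trans ?_)
    rw [σ.apply_symm_apply, hv]
  rw [← himage, σ.symm_apply_apply]

theorem TIsomorphic.trans (h : TIsomorphic H w W W') (h' : TIsomorphic H w W' W'') :
    TIsomorphic H w W W'' := by
  obtain ⟨σ, hσ⟩ := h
  obtain ⟨τ, hτ⟩ := h'
  exact ⟨σ.trans τ, fun B hB u v hv => hτ B hB (σ u) (σ v) (hσ B hB u v hv)⟩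

theorem HasEndpoint.dualIdempotent_mulVec_eq_zero {r i : ℕ} (hr : HasEndpoint H w W r)
    (hi : i < r) {g : V → ℂ} (hg : g ∈ W) : dualIdempotent H w i *ᵥ g = 0 := by
  by_contra hne
  exact hi.not_ge (hr.2 ((Submodule.ne_bot_iff _).2 ⟨_, ⟨g, hg, rfl⟩, hne⟩))

theorem HasEndpoint.apply_base_eq_zero (hW : HasEndpoint H w W 1) {g : V → ℂ} (hg : g ∈ W) :
    g w = 0 := by
  simpa [dualIdempotent_mulVec_apply] using
    congrFun (hW.dualIdempotent_mulVec_eq_zero one_pos hg) w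

end TModule

section SumZero

variable {Y : Type*} [Fintype Y] {S : SimpleGraph Y}

theorem exists_iso_bot_fin_iff {m : ℕ} (hY : m ≤ Fintype.card Y) :
    (∃ n : ℕ, m ≤ n ∧ Nonempty (S ≃g (⊥ : SimpleGraph (Fin n)))) ↔ S = ⊥ := by
  refine ⟨fun ⟨n, _, ⟨e⟩⟩ => ?_, ?_⟩
  · ext y y'
    simp [← e.map_adj_iff]
  · rintro rfl
    exact ⟨_, hY, ⟨Fintype.equivFin Y, by simp⟩⟩

theorem exists_iso_top_fin_iff {m : ℕ} (hY : m ≤ Fintype.card Y) :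
    (∃ n : ℕ, m ≤ n ∧ Nonempty (S ≃g (⊤ : SimpleGraph (Fin n)))) ↔ S = ⊤ := by
  refine ⟨fun ⟨n, _, ⟨e⟩⟩ => ?_, ?_⟩
  · ext y y'
    simp [← e.map_adj_iff]
  · rintro rfl
    exact ⟨_, hY, ⟨SimpleGraph.Iso.completeGraph (Fintype.equivFin Y)⟩⟩

variable [DecidableRel S.Adj]

/-- `v` is a `θ`-eigenvector of the adjacency matrix of `S` orthogonal to the all-ones vector.
These vectors give rise to the irreducible modules of endpoint `1` (see `coneLift`). -/
structure IsCenteredEigenvector (S : SimpleGraph Y) [DecidableRel S.Adj] (θ : ℂ) (v : Y → ℂ) :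
    Prop where
  ne_zero : v ≠ 0
  sum_eq_zero : ∑ y, v y = 0
  mulVec_eq : S.adjMatrix ℂ *ᵥ v = θ • v

/-- The adjacency matrix of `S` acts as the scalar `θ` on the orthogonal complement of the all-ones
vector; this is the spectral form of being empty or complete. -/
def IsScalarOnSumZero (S : SimpleGraph Y) [DecidableRel S.Adj] (θ : ℂ) : Prop :=
  ∀ v : Y → ℂ, ∑ y, v y = 0 → S.adjMatrix ℂ *ᵥ v = θ • v

theorem sum_adjMatrix_mulVec_of_regular {R : Type*} [Semiring R] {k : ℕ}
    (hk : S.IsRegularOfDegree k) (v : Y → R) :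
    ∑ y, (S.adjMatrix R *ᵥ v) y = k * ∑ y, v y := by
  have hone : 1 ᵥ* S.adjMatrix R = (k : R) • 1 := by
    ext y
    simp [SimpleGraph.adjMatrix_vecMul_apply, hk.degree_eq y]
  rw [← one_dotProduct, dotProduct_mulVec, hone, smul_dotProduct, one_dotProduct, smul_eq_mul]

theorem exists_isScalarOnSumZero_of_unique_eigenvalue {k : ℕ} (hk : S.IsRegularOfDegree k)
    (huniq : ∀ θ θ' v v', IsCenteredEigenvector S θ v → IsCenteredEigenvector S θ' v' → θ = θ') :
    ∃ θ, IsScalarOnSumZero S θ := by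
  classical
  set T := toEuclideanLin (S.adjMatrix ℂ)
  let Z : Submodule ℂ (EuclideanSpace ℂ Y) := LinearMap.ker (∑ y, EuclideanSpace.projₗ y)
  have mem_Z : ∀ v, v ∈ Z ↔ ∑ y, v y = 0 := fun v => by simp [Z]
  have hT : T.IsSymmetric := isSymmetric_toEuclideanLin_iff.2 (S.isHermitian_adjMatrix ℂ)
  have hZ : ∀ v ∈ Z, T v ∈ Z := fun v hv => by
    rw [mem_Z] at hv ⊢
    exact (sum_adjMatrix_mulVec_of_regular hk v.ofLp).trans (by rw [hv, mul_zero])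
  have hcentered : ∀ θ, Module.End.HasEigenvalue (T.restrict hZ) θ →
      ∃ v, IsCenteredEigenvector S θ v := fun θ hθ => by
    obtain ⟨v, hv⟩ := hθ.exists_hasEigenvector
    refine ⟨(v : EuclideanSpace ℂ Y).ofLp, ?_, (mem_Z _).1 v.2, ?_⟩
    · simpa using hv.2
    · exact congrArg (fun u : Z => (u : EuclideanSpace ℂ Y).ofLp) hv.apply_eq_smul
  obtain ⟨θ, hθ⟩ := exists_eq_smul_id_of_subsingleton_eigenvalues (hT.restrict_invariant hZ)
    fun μ ν hμ hν => by
      obtain ⟨v, hv⟩ := hcentered μ hμ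
      obtain ⟨u, hu⟩ := hcentered ν hν
      exact huniq μ ν v u hv hu
  exact ⟨θ, fun v hv => congrArg (fun u : Z => (u : EuclideanSpace ℂ Y).ofLp)
    (hθ ⟨WithLp.toLp 2 v, (mem_Z _).2 hv⟩)⟩

theorem IsScalarOnSumZero.isCenteredEigenvector_single_sub_single [DecidableEq Y] {θ : ℂ}
    (hS : IsScalarOnSumZero S θ) {y y' : Y} (hne : y ≠ y') :
    IsCenteredEigenvector S θ (Pi.single y 1 - Pi.single y' 1) where
  ne_zero := Function.ne_iff.2 ⟨y, by simp [hne]⟩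
  sum_eq_zero := by simp
  mulVec_eq := hS _ (by simp)

theorem IsScalarOnSumZero.eq_bot_or_eq_top {θ : ℂ} (hS : IsScalarOnSumZero S θ) :
    S = ⊥ ∨ S = ⊤ := by
  classical
  have hadj : ∀ y y', y ≠ y' → (if S.Adj y y' then (1 : ℂ) else 0) = -θ := by
    intro y y' hne
    have := congrFun (hS.isCenteredEigenvector_single_sub_single hne).mulVec_eq y
    rw [mulVec_sub] at this
    simpa [hne, neg_eq_iff_eq_neg] using this
  obtain rfl | hθ := eq_or_ne θ 0
  · refine Or.inl (SimpleGraph.ext (funext₂ fun y y' => propext ⟨fun h => ?_, False.elim⟩))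
    simpa [h] using hadj y y' h.ne
  · refine Or.inr (SimpleGraph.ext (funext₂ fun y y' => propext ⟨SimpleGraph.Adj.ne, fun h => ?_⟩))
    by_contra hyy'
    exact hθ (by simpa [hyy'] using hadj y y' h)

theorem exists_isScalarOnSumZero_iff_eq_bot_or_eq_top :
    (∃ θ, IsScalarOnSumZero S θ) ↔ S = ⊥ ∨ S = ⊤ := by
  classical
  refine ⟨fun ⟨_, hS⟩ => hS.eq_bot_or_eq_top, ?_⟩
  rintro (rfl | rfl)
  · refine ⟨0, fun v _ => ?_⟩
    ext y
    simp [SimpleGraph.adjMatrix_mulVec_apply]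
  · refine ⟨-1, fun v hv => ?_⟩
    ext y
    have hoff : ∀ y', (if y = y' then 0 else v y') = v y' - if y = y' then v y' else 0 :=
      fun y' => by split_ifs <;> simp
    simp [mulVec, dotProduct, SimpleGraph.adjMatrix_apply, hoff, hv]

end SumZero

section AdjacencyAction

variable {X Y : Type*} [Fintype X] [Fintype Y] {R : Type*} [NonAssocSemiring R]

open Classical in
theorem coneGraph_adjMatrix_mulVec_none (G : SimpleGraph X) (S : SimpleGraph Y) (x : X)
    (g : Option (X × Y) → R) :
    ((coneGraph G S x).adjMatrix R *ᵥ g) none = ∑ y, g (some (x, y)) := by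
  have hadj : ∀ p : X × Y, (coneGraph G S x).Adj none (some p) ↔ p.1 = x := fun _ => Iff.rfl
  simp only [mulVec, dotProduct, SimpleGraph.adjMatrix_apply, Fintype.sum_option,
    Fintype.sum_prod_type, hadj]
  rw [Finset.sum_eq_single x] <;> simp +contextual

open Classical in
theorem coneGraph_adjMatrix_mulVec_some (G : SimpleGraph X) (S : SimpleGraph Y)
    [DecidableRel S.Adj] (x : X) (g : Option (X × Y) → R) (z : X) (y : Y) :
    ((coneGraph G S x).adjMatrix R *ᵥ g) (some (z, y)) =
      (if z = x then g none else 0) + (G.adjMatrix R *ᵥ fun u => g (some (u, y))) z +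
        (S.adjMatrix R *ᵥ fun y' => g (some (z, y'))) y := by
  have hadj_none : (coneGraph G S x).Adj (some (z, y)) none ↔ z = x := Iff.rfl
  have hadj_some : ∀ u y', (if (coneGraph G S x).Adj (some (z, y)) (some (u, y')) then 1 else 0) =
      (if y = y' then if G.Adj z u then (1 : R) else 0 else 0) +
        if z = u then if S.Adj y y' then 1 else 0 else 0 := by
    intro u y'
    have hadj : (coneGraph G S x).Adj (some (z, y)) (some (u, y')) ↔
      G.Adj z u ∧ y = y' ∨ S.Adj y y' ∧ z = u := SimpleGraph.boxProd_adj
    rw [hadj]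
    by_cases hy : y = y' <;> by_cases hz : z = u <;> subst_vars <;> simp [*]
  simp only [mulVec, dotProduct, SimpleGraph.adjMatrix_apply, Fintype.sum_option,
    Fintype.sum_prod_type, hadj_none, hadj_some, add_mul, Finset.sum_add_distrib, add_assoc]
  rw [Finset.sum_comm (f := fun u y' => (if z = u then _ else _) * _)]
  simp

end AdjacencyAction

section WeightRegular

variable {X : Type*} [Fintype X] {G : SimpleGraph X} {x : X} {α : X → ℝ} {p : ℕ → ℕ → ℝ}

/-- The distance partition around `x` is weight-regular for the positive weight `α`, with quotient
matrix `p`: the weighted number of neighbours at distance `j` from `x` of a vertex `z` is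
`p (G.dist x z) j`. The entries of `p` at distances that do not occur are unconstrained. -/
structure IsWeightRegularAround (G : SimpleGraph X) (x : X) (α : X → ℝ) (p : ℕ → ℕ → ℝ) :
    Prop where
  weight_pos : ∀ z, 0 < α z
  weightedCount_eq : ∀ z j, weightedCount G x α z j = p (G.dist x z) j

theorem weightedCount_eq_zero {z : X} {j : ℕ} (h : ∀ u, G.Adj z u → G.dist x u ≠ j) :
    weightedCount G x α z j = 0 :=
  Finset.sum_eq_zero fun u _ => if_neg fun ⟨hzu, hu⟩ => h u hzu hu

theorem weightedCount_pos (hα : ∀ z, 0 < α z) {z u : X} (hzu : G.Adj z u) :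
    0 < weightedCount G x α z (G.dist x u) := by
  classical
  refine Finset.sum_pos' (fun v _ => ?_) ⟨u, Finset.mem_univ u, ?_⟩
  · have := div_pos (hα v) (hα z)
    positivity
  · rw [if_pos ⟨hzu, rfl⟩]
    exact div_pos (hα u) (hα z)

theorem IsPseudoDistanceRegularAround.exists_isWeightRegularAround
    (hx : IsPseudoDistanceRegularAround G x) :
    ∃ (α : X → ℝ) (p : ℕ → ℕ → ℝ), IsWeightRegularAround G x α p := by
  obtain ⟨α, -, hα, -, c, a, b, hc, ha, hb⟩ := hx
  refine ⟨α, fun i j => if i = j + 1 then c i else if i = j then a i else if j = i + 1 then b i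
    else 0, hα, fun z j => ?_⟩
  split_ifs with hlower hsame hupper
  · rw [hlower, hc j z hlower]
  · rw [← hsame, ha _ z rfl]
  · rw [hupper, hb _ z rfl]
  · refine weightedCount_eq_zero fun u hzu hu => ?_
    have := hzu.diff_dist_adj (u := x)
    omega

/-- The action of the quotient matrix `p` of the distance partition around `x` on sequences indexed
by the distance from `x`; the sum runs over the distances that occur. -/
noncomputable def quotientAction (G : SimpleGraph X) (x : X) (p : ℕ → ℕ → ℝ) (f : ℕ → ℂ) (i : ℕ) :
    ℂ :=
  ∑ j ∈ Finset.univ.image (G.dist x), p i j * f j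

theorem quotientAction_single (p : ℕ → ℕ → ℝ) (z : X) (i : ℕ) :
    quotientAction G x p (Pi.single (G.dist x z) 1) i = p i (G.dist x z) := by
  classical
  rw [quotientAction, Finset.sum_eq_single_of_mem (G.dist x z)
    (Finset.mem_image_of_mem _ (Finset.mem_univ z))]
  · simp
  · intro j _ hj
    simp [hj]

theorem IsWeightRegularAround.quotient_pos (hα : IsWeightRegularAround G x α p) {z u : X}
    (hzu : G.Adj z u) : 0 < p (G.dist x z) (G.dist x u) :=
  hα.weightedCount_eq z _ ▸ weightedCount_pos hα.weight_pos hzu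

theorem IsWeightRegularAround.quotient_zero_zero (hα : IsWeightRegularAround G x α p) :
    p 0 0 = 0 := by
  rw [← SimpleGraph.dist_self (G := G) (v := x), ← hα.weightedCount_eq x, SimpleGraph.dist_self]
  refine weightedCount_eq_zero fun u hu => ?_
  rw [SimpleGraph.dist_eq_one_iff_adj.2 hu]
  exact one_ne_zero

open Classical in
theorem IsWeightRegularAround.adjMatrix_mulVec_apply (hα : IsWeightRegularAround G x α p)
    (f : ℕ → ℂ) (z : X) :
    (G.adjMatrix ℂ *ᵥ fun u => f (G.dist x u) * α u) z =
      quotientAction G x p f (G.dist x z) * α z := by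
  have hz : (α z : ℂ) ≠ 0 := Complex.ofReal_ne_zero.2 (hα.weight_pos z).ne'
  have hfiber : ∀ j, (p (G.dist x z) j : ℂ) * f j * α z =
      ∑ u with G.dist x u = j, G.adjMatrix ℂ z u * (f (G.dist x u) * α u) := by
    intro j
    rw [← hα.weightedCount_eq, weightedCount, Complex.ofReal_sum, Finset.sum_mul, Finset.sum_mul,
      Finset.sum_filter]
    refine Finset.sum_congr rfl fun u _ => ?_
    by_cases hzu : G.Adj z u <;> by_cases hu : G.dist x u = j <;> simp [hzu, hu]
    field_simp
  simp only [quotientAction, Finset.sum_mul, hfiber]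
  exact (Finset.sum_fiberwise_of_maps_to
    (fun u _ => Finset.mem_image_of_mem _ (Finset.mem_univ u)) _).symm

end WeightRegular

section Lift

variable {X Y : Type*} {G : SimpleGraph X} {x : X} {α : X → ℝ} {v : Y → ℂ}

/-- The vector `(f ∘ G.dist x) α ⊗ v` on the vertices of the cone, extended by `0` to the new
vertex; as a function of the sequence `f` it parametrises a candidate for an irreducible module.
The value `f i` sits on the vertices of the cone at distance `i + 1` from the new vertex. -/
noncomputable def coneLift (G : SimpleGraph X) (x : X) (α : X → ℝ) (v : Y → ℂ) :
    (ℕ → ℂ) →ₗ[ℂ] (Option (X × Y) → ℂ) where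
  toFun f o := o.elim 0 fun q => f (G.dist x q.1) * α q.1 * v q.2
  map_add' f g := by ext (_ | q) <;> simp [add_mul]
  map_smul' c f := by ext (_ | q) <;> simp [mul_assoc]

@[simp]
theorem coneLift_none (f : ℕ → ℂ) : coneLift G x α v f none = 0 :=
  rfl

@[simp]
theorem coneLift_some (f : ℕ → ℂ) (z : X) (y : Y) :
    coneLift G x α v f (some (z, y)) = f (G.dist x z) * α z * v y :=
  rfl

theorem coneLift_eq_zero_iff (hα : ∀ z, 0 < α z) (hv : v ≠ 0) {f : ℕ → ℂ} :
    coneLift G x α v f = 0 ↔ ∀ z, f (G.dist x z) = 0 := by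
  obtain ⟨y, hy⟩ := Function.ne_iff.1 hv
  refine ⟨fun h z => ?_, fun h => ?_⟩
  · have hz : f (G.dist x z) * α z * v y = 0 := congrFun h (some (z, y))
    simpa [(hα z).ne', show v y ≠ 0 from hy] using hz
  · ext (_ | ⟨z, y⟩) <;> simp [h]

theorem coneLift_single_zero_ne_zero (hα : ∀ z, 0 < α z) (hv : v ≠ 0) :
    coneLift G x α v (Pi.single 0 1) ≠ 0 := fun h => by
  simpa using (coneLift_eq_zero_iff hα hv).1 h x

theorem coneLift_eq_sum [Fintype X] (f : ℕ → ℂ) :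
    coneLift G x α v f = ∑ i ∈ Finset.univ.image (G.dist x),
      f i • coneLift G x α v (Pi.single i 1) := by
  ext (_ | ⟨z, y⟩)
  · simp
  · rw [Finset.sum_apply, Finset.sum_eq_single_of_mem (G.dist x z)
      (Finset.mem_image_of_mem _ (Finset.mem_univ z))]
    · simp [mul_assoc]
    · intro i _ hi
      simp [hi.symm]

open Classical in
theorem adjMatrix_mulVec_coneLift [Fintype X] [Fintype Y] {S : SimpleGraph Y} [DecidableRel S.Adj]
    {p : ℕ → ℕ → ℝ} {θ : ℂ} (hα : IsWeightRegularAround G x α p)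
    (hv : IsCenteredEigenvector S θ v) (f : ℕ → ℂ) :
    (coneGraph G S x).adjMatrix ℂ *ᵥ coneLift G x α v f =
      coneLift G x α v (quotientAction G x p f + θ • f) := by
  ext (_ | ⟨z, y⟩)
  · simp only [coneGraph_adjMatrix_mulVec_none, coneLift_some, coneLift_none, ← Finset.mul_sum,
      hv.sum_eq_zero, mul_zero]
  · have hX : (G.adjMatrix ℂ *ᵥ fun u => f (G.dist x u) * α u * v y) z =
        quotientAction G x p f (G.dist x z) * α z * v y := by
      rw [← hα.adjMatrix_mulVec_apply]
      simp only [mulVec, dotProduct, Finset.sum_mul, mul_assoc]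
    have hY : (S.adjMatrix ℂ *ᵥ fun y' => f (G.dist x z) * α z * v y') y =
        f (G.dist x z) * α z * (θ * v y) := by
      have := congrFun (mulVec_smul (S.adjMatrix ℂ) (f (G.dist x z) * α z) v) y
      rwa [hv.mulVec_eq] at this
    simp only [coneGraph_adjMatrix_mulVec_some, coneLift_some, coneLift_none, hX, hY, Pi.add_apply,
      Pi.smul_apply, smul_eq_mul, ite_self]
    ring

variable [Fintype X] [DecidableEq X] [Fintype Y] [DecidableEq Y] {S : SimpleGraph Y}

theorem dualIdempotent_zero_mulVec_coneLift (hG : G.Connected) (f : ℕ → ℂ) :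
    dualIdempotent (coneGraph G S x) none 0 *ᵥ coneLift G x α v f = 0 := by
  ext (_ | ⟨z, y⟩) <;> simp [dualIdempotent_mulVec_apply, coneGraph_dist_some hG]

theorem dualIdempotent_succ_mulVec_coneLift (hG : G.Connected) (i : ℕ) (f : ℕ → ℂ) :
    dualIdempotent (coneGraph G S x) none (i + 1) *ᵥ coneLift G x α v f =
      f i • coneLift G x α v (Pi.single i 1) := by
  ext (_ | ⟨z, y⟩)
  · simp [dualIdempotent_mulVec_apply]
  · by_cases hz : G.dist x z = i <;>
      simp [dualIdempotent_mulVec_apply, coneGraph_dist_some hG, hz, mul_assoc]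

theorem hasEndpoint_range_coneLift (hG : G.Connected) (hα : ∀ z, 0 < α z) (hv : v ≠ 0) :
    HasEndpoint (coneGraph G S x) none (LinearMap.range (coneLift G x α v)) 1 := by
  refine ⟨(Submodule.ne_bot_iff _).2 ⟨coneLift G x α v (Pi.single 0 1),
    ⟨_, ⟨Pi.single 0 1, rfl⟩, ?_⟩, coneLift_single_zero_ne_zero hα hv⟩,
    fun i hi => Nat.one_le_iff_ne_zero.2 ?_⟩
  · rw [mulVecLin_apply, dualIdempotent_succ_mulVec_coneLift hG, Pi.single_eq_same, one_smul]
  · rintro rfl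
    refine hi ((Submodule.eq_bot_iff _).2 ?_)
    rintro _ ⟨_, ⟨f, rfl⟩, rfl⟩
    exact dualIdempotent_zero_mulVec_coneLift hG f

theorem isThin_range_coneLift (hG : G.Connected) :
    IsThin (coneGraph G S x) none (LinearMap.range (coneLift G x α v)) := by
  intro i
  have hle : component (coneGraph G S x) none i (LinearMap.range (coneLift G x α v)) ≤
      ℂ ∙ coneLift G x α v (Pi.single (i - 1) 1) := by
    rintro _ ⟨_, ⟨f, rfl⟩, rfl⟩
    rw [mulVecLin_apply, Submodule.mem_span_singleton]
    cases i with
    | zero => exact ⟨0, by rw [dualIdempotent_zero_mulVec_coneLift hG, zero_smul]⟩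
    | succ i => exact ⟨f i, (dualIdempotent_succ_mulVec_coneLift hG i f).symm⟩
  simpa using (Submodule.finrank_mono hle).trans (finrank_span_le_card {_})

end Lift

section Irreducible

variable {X Y : Type*} [Fintype X] [DecidableEq X] [Fintype Y] [DecidableEq Y] {G : SimpleGraph X}
  {x : X} {α : X → ℝ} {p : ℕ → ℕ → ℝ} {S : SimpleGraph Y} [DecidableRel S.Adj] {v v' : Y → ℂ}
  {θ θ' : ℂ} {U W : Submodule ℂ (Option (X × Y) → ℂ)}

theorem isTModule_range_coneLift (hG : G.Connected) (hα : IsWeightRegularAround G x α p)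
    (hv : IsCenteredEigenvector S θ v) :
    IsTModule (coneGraph G S x) none (LinearMap.range (coneLift G x α v)) := by
  refine isTModule_iff.2 ⟨?_, ?_⟩
  · rintro _ ⟨f, rfl⟩
    exact ⟨_, (adjMatrix_mulVec_coneLift hα hv f).symm⟩
  · rintro (_ | i) _ ⟨f, rfl⟩
    · rw [dualIdempotent_zero_mulVec_coneLift hG]
      exact Submodule.zero_mem _
    · rw [dualIdempotent_succ_mulVec_coneLift hG]
      exact Submodule.smul_mem _ _ ⟨_, rfl⟩

theorem IsTModule.coneLift_single_mem_of_adj (hU : IsTModule (coneGraph G S x) none U)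
    (hG : G.Connected) (hα : IsWeightRegularAround G x α p) (hv : IsCenteredEigenvector S θ v)
    {z u : X} (hzu : G.Adj z u) (hz : coneLift G x α v (Pi.single (G.dist x z) 1) ∈ U) :
    coneLift G x α v (Pi.single (G.dist x u) 1) ∈ U := by
  classical
  by_cases hdist : G.dist x u = G.dist x z
  · rwa [hdist]
  have hmem := hU.dualIdempotent_mulVec_mem (G.dist x u + 1) (hU.adjMatrix_mulVec_mem hz)
  have hcoeff : (p (G.dist x u) (G.dist x z) : ℂ) ≠ 0 :=
    Complex.ofReal_ne_zero.2 (hα.quotient_pos hzu.symm).ne'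
  rw [adjMatrix_mulVec_coneLift hα hv, dualIdempotent_succ_mulVec_coneLift hG, Pi.add_apply,
    quotientAction_single, Pi.smul_apply, Pi.single_eq_of_ne hdist, smul_zero, add_zero] at hmem
  exact (U.smul_mem_iff hcoeff).1 hmem

theorem IsTModule.coneLift_single_mem (hU : IsTModule (coneGraph G S x) none U)
    (hG : G.Connected) (hα : IsWeightRegularAround G x α p) (hv : IsCenteredEigenvector S θ v)
    {z : X} (hz : coneLift G x α v (Pi.single (G.dist x z) 1) ∈ U) (u : X) :
    coneLift G x α v (Pi.single (G.dist x u) 1) ∈ U := by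
  obtain ⟨P⟩ := hG.preconnected z u
  induction P with
  | nil => exact hz
  | cons hadj _ ih => exact ih (hU.coneLift_single_mem_of_adj hG hα hv hadj hz)

theorem IsTModule.range_coneLift_le (hU : IsTModule (coneGraph G S x) none U)
    (hG : G.Connected) (hα : IsWeightRegularAround G x α p) (hv : IsCenteredEigenvector S θ v)
    {f : ℕ → ℂ} (hf : coneLift G x α v f ∈ U) (hf0 : coneLift G x α v f ≠ 0) :
    LinearMap.range (coneLift G x α v) ≤ U := by
  obtain ⟨z, hz⟩ : ∃ z, f (G.dist x z) ≠ 0 := by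
    contrapose! hf0
    exact (coneLift_eq_zero_iff hα.weight_pos hv.ne_zero).2 hf0
  have hzU : coneLift G x α v (Pi.single (G.dist x z) 1) ∈ U := by
    have hmem := hU.dualIdempotent_mulVec_mem (G.dist x z + 1) hf
    rw [dualIdempotent_succ_mulVec_coneLift hG] at hmem
    exact (U.smul_mem_iff hz).1 hmem
  rintro _ ⟨g, rfl⟩
  rw [coneLift_eq_sum]
  refine U.sum_mem fun i hi => U.smul_mem _ ?_
  obtain ⟨u, -, rfl⟩ := Finset.mem_image.1 hi
  exact hU.coneLift_single_mem hG hα hv hzU u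

theorem isIrreducibleTModule_range_coneLift (hG : G.Connected)
    (hα : IsWeightRegularAround G x α p) (hv : IsCenteredEigenvector S θ v) :
    IsIrreducibleTModule (coneGraph G S x) none (LinearMap.range (coneLift G x α v)) := by
  refine ⟨isTModule_range_coneLift hG hα hv, (Submodule.ne_bot_iff _).2
    ⟨_, ⟨_, rfl⟩, coneLift_single_zero_ne_zero hα.weight_pos hv.ne_zero⟩, fun U hUle hU => ?_⟩
  refine or_iff_not_imp_left.2 fun hbot => hUle.antisymm ?_
  obtain ⟨g, hg, hg0⟩ := (Submodule.ne_bot_iff _).1 hbot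
  obtain ⟨f, rfl⟩ := hUle hg
  exact hU.range_coneLift_le hG hα hv hg hg0

theorem tIsomorphic_range_coneLift (hG : G.Connected) (hα : IsWeightRegularAround G x α p)
    (hv : IsCenteredEigenvector S θ v) (hv' : IsCenteredEigenvector S θ v') :
    TIsomorphic (coneGraph G S x) none (LinearMap.range (coneLift G x α v))
      (LinearMap.range (coneLift G x α v')) := by
  classical
  have hker : LinearMap.ker (coneLift G x α v) = LinearMap.ker (coneLift G x α v') := by
    ext f
    rw [LinearMap.mem_ker, LinearMap.mem_ker, coneLift_eq_zero_iff hα.weight_pos hv.ne_zero,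
      coneLift_eq_zero_iff hα.weight_pos hv'.ne_zero]
  obtain ⟨σ, hσ⟩ := exists_linearEquiv_range_of_ker_eq hker
  have hσ_apply : ∀ (g : LinearMap.range (coneLift G x α v)) (f : ℕ → ℂ),
      (g : Option (X × Y) → ℂ) = coneLift G x α v f → (σ g : Option (X × Y) → ℂ) =
        coneLift G x α v' f := by
    intro g f hg
    rw [← hσ]
    exact congrArg (fun a => (σ a : Option (X × Y) → ℂ)) (Subtype.ext hg)
  refine tIsomorphic_of_commute_generators (isTModule_range_coneLift hG hα hv) σ ?_ ?_
  · rintro ⟨_, f, rfl⟩ g hg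
    rw [hσ_apply ⟨_, f, rfl⟩ f rfl, adjMatrix_mulVec_coneLift hα hv']
    exact hσ_apply g _ (hg.trans (adjMatrix_mulVec_coneLift hα hv f))
  · rintro (_ | i) ⟨_, f, rfl⟩ g hg
    · rw [hσ_apply ⟨_, f, rfl⟩ f rfl, dualIdempotent_zero_mulVec_coneLift hG]
      rw [dualIdempotent_zero_mulVec_coneLift hG] at hg
      exact (hσ_apply g 0 (hg.trans (map_zero _).symm)).trans (map_zero _)
    · rw [hσ_apply ⟨_, f, rfl⟩ f rfl, dualIdempotent_succ_mulVec_coneLift hG, ← map_smul]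
      rw [dualIdempotent_succ_mulVec_coneLift hG, ← map_smul] at hg
      exact hσ_apply g _ hg

theorem localOperator_mulVec_of_mem_range_coneLift (hG : G.Connected)
    (hα : IsWeightRegularAround G x α p) (hv : IsCenteredEigenvector S θ v)
    {g : Option (X × Y) → ℂ} (hg : g ∈ LinearMap.range (coneLift G x α v)) :
    localOperator (coneGraph G S x) none *ᵥ g =
      θ • dualIdempotent (coneGraph G S x) none 1 *ᵥ g := by
  classical
  obtain ⟨f, rfl⟩ := hg
  have hQ : quotientAction G x p (Pi.single 0 1) 0 = 0 := by
    simpa [hα.quotient_zero_zero] using quotientAction_single (G := G) (x := x) p x 0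
  rw [localOperator, ← mulVec_mulVec, dualIdempotent_succ_mulVec_coneLift hG, ← mulVec_mulVec,
    mulVec_smul, mulVec_smul, adjMatrix_mulVec_coneLift hα hv,
    dualIdempotent_succ_mulVec_coneLift hG, Pi.add_apply, hQ, zero_add, Pi.smul_apply,
    Pi.single_eq_same, smul_eq_mul, mul_one, smul_comm]

theorem eigenvalue_eq_of_tIsomorphic (hG : G.Connected) (hα : IsWeightRegularAround G x α p)
    (hv : IsCenteredEigenvector S θ v) (hv' : IsCenteredEigenvector S θ' v')
    (h : TIsomorphic (coneGraph G S x) none (LinearMap.range (coneLift G x α v))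
      (LinearMap.range (coneLift G x α v'))) : θ = θ' := by
  obtain ⟨σ, hσ⟩ := h
  set g : LinearMap.range (coneLift G x α v) := ⟨coneLift G x α v (Pi.single 0 1), _, rfl⟩
  set E := dualIdempotent (coneGraph G S x) none 1
  have hEg : E *ᵥ (g : Option (X × Y) → ℂ) = g := by
    rw [dualIdempotent_succ_mulVec_coneLift hG, Pi.single_eq_same, one_smul]
  have hσ_fixed : (σ g : Option (X × Y) → ℂ) = E *ᵥ (σ g : Option (X × Y) → ℂ) :=
    hσ E (dualIdempotent_mem_terwilligerAlgebra _ _ 1) g g hEg.symm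
  have hσ_local := hσ _ (localOperator_mem_terwilligerAlgebra _ _) g (θ • g)
    (by rw [localOperator_mulVec_of_mem_range_coneLift hG hα hv g.2, hEg, Submodule.coe_smul])
  rw [localOperator_mulVec_of_mem_range_coneLift hG hα hv' (σ g).2, ← hσ_fixed,
    map_smul] at hσ_local
  have hg : g ≠ 0 := fun h =>
    coneLift_single_zero_ne_zero hα.weight_pos hv.ne_zero (congrArg Subtype.val h)
  exact smul_left_injective ℂ (σ.map_ne_zero_iff.2 hg) (Subtype.ext hσ_local)

theorem HasUniqueThinEndpointOne.eigenvalue_eq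
    (h : HasUniqueThinEndpointOne (coneGraph G S x) none) (hG : G.Connected)
    (hα : IsWeightRegularAround G x α p) (hv : IsCenteredEigenvector S θ v)
    (hv' : IsCenteredEigenvector S θ' v') : θ = θ' := by
  obtain ⟨W, ⟨hW, -⟩, -, huniq⟩ := h
  have hiso : ∀ {θ v}, IsCenteredEigenvector S θ v →
      TIsomorphic (coneGraph G S x) none W (LinearMap.range (coneLift G x α v)) := fun hv =>
    huniq _ (isIrreducibleTModule_range_coneLift hG hα hv)
      (hasEndpoint_range_coneLift hG hα.weight_pos hv.ne_zero)
  exact eigenvalue_eq_of_tIsomorphic hG hα hv hv' (((hiso hv).symm hW.1).trans (hiso hv'))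

theorem IsScalarOnSumZero.exists_eq_range_coneLift (hS : IsScalarOnSumZero S θ)
    (hG : G.Connected) (hα : IsWeightRegularAround G x α p)
    (hW : IsIrreducibleTModule (coneGraph G S x) none W)
    (hend : HasEndpoint (coneGraph G S x) none W 1) :
    ∃ v, IsCenteredEigenvector S θ v ∧ W = LinearMap.range (coneLift G x α v) := by
  classical
  obtain ⟨_, ⟨g, hg, rfl⟩, hg0⟩ := (Submodule.ne_bot_iff _).1 hend.1
  set v : Y → ℂ := fun y => g (some (x, y))
  have hlift : coneLift G x α v (Pi.single 0 1) =
      (α x : ℂ) • dualIdempotent (coneGraph G S x) none 1 *ᵥ g := by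
    ext (_ | ⟨z, y⟩)
    · simp [dualIdempotent_mulVec_apply]
    · obtain rfl | hz := eq_or_ne z x
      · simp [v, dualIdempotent_mulVec_apply, coneGraph_dist_some hG]
      · have hdist : G.dist x z ≠ 0 := fun h => hz (hG.dist_eq_zero_iff.1 h).symm
        simp [dualIdempotent_mulVec_apply, coneGraph_dist_some hG, hdist]
  have hlift0 : coneLift G x α v (Pi.single 0 1) ≠ 0 := by
    rw [hlift]
    exact smul_ne_zero (Complex.ofReal_ne_zero.2 (hα.weight_pos x).ne') hg0
  have hsum : ∑ y, v y = 0 := by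
    rw [← coneGraph_adjMatrix_mulVec_none G S x g]
    exact hend.apply_base_eq_zero (hW.1.adjMatrix_mulVec_mem hg)
  have hv : IsCenteredEigenvector S θ v := by
    refine ⟨fun h => hlift0 ?_, hsum, hS v hsum⟩
    ext (_ | ⟨z, y⟩) <;> simp [h]
  have hle : LinearMap.range (coneLift G x α v) ≤ W := by
    refine hW.1.range_coneLift_le hG hα hv ?_ hlift0
    rw [hlift]
    exact W.smul_mem _ (hW.1.dualIdempotent_mulVec_mem 1 hg)
  obtain hbot | htop := hW.2.2 _ hle (isTModule_range_coneLift hG hα hv)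
  · exact ((isIrreducibleTModule_range_coneLift hG hα hv).2.1 hbot).elim
  · exact ⟨v, hv, htop.symm⟩

theorem IsScalarOnSumZero.hasUniqueThinEndpointOne [Nontrivial Y] (hS : IsScalarOnSumZero S θ)
    (hG : G.Connected) (hα : IsWeightRegularAround G x α p) :
    HasUniqueThinEndpointOne (coneGraph G S x) none := by
  obtain ⟨y, y', hne⟩ := exists_pair_ne Y
  have hv := hS.isCenteredEigenvector_single_sub_single hne
  refine ⟨_, ⟨isIrreducibleTModule_range_coneLift hG hα hv,
    hasEndpoint_range_coneLift hG hα.weight_pos hv.ne_zero⟩, isThin_range_coneLift hG, ?_⟩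
  intro W hW hend
  obtain ⟨v, hv', rfl⟩ := hS.exists_eq_range_coneLift hG hα hW hend
  exact tIsomorphic_range_coneLift hG hα hv hv'

end Irreducible

end TerwilligerGraph

open TerwilligerGraph

theorem mainTheorem2 {X Y : Type*} [Fintype X] [DecidableEq X] [Fintype Y] [DecidableEq Y]
    (G : SimpleGraph X) (hG : G.Connected) (x : X)
    (hx : TerwilligerGraph.IsPseudoDistanceRegularAround G x)
    (S : SimpleGraph Y) [DecidableRel S.Adj] (hS : ∃ k : ℕ, S.IsRegularOfDegree k)
    (hY : 2 ≤ Fintype.card Y) :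
    TerwilligerGraph.HasUniqueThinEndpointOne (TerwilligerGraph.coneGraph G S x) none ↔
      (∃ n : ℕ, 2 ≤ n ∧ Nonempty (S ≃g (⊥ : SimpleGraph (Fin n)))) ∨
      (∃ n : ℕ, 2 ≤ n ∧ Nonempty (S ≃g (⊤ : SimpleGraph (Fin n)))) := by
  obtain ⟨k, hk⟩ := hS
  obtain ⟨α, p, hα⟩ := hx.exists_isWeightRegularAround
  rw [exists_iso_bot_fin_iff hY, exists_iso_top_fin_iff hY,
    ← exists_isScalarOnSumZero_iff_eq_bot_or_eq_top]
  constructor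
  · intro hunique
    exact exists_isScalarOnSumZero_of_unique_eigenvalue hk fun _ _ _ _ hv hv' =>
      hunique.eigenvalue_eq hG hα hv hv'
  · rintro ⟨θ, hscalar⟩
    have : Nontrivial Y := Fintype.one_lt_card_iff_nontrivial.1 hY
    exact hscalar.hasUniqueThinEndpointOne hG hα
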